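/- Let $K\subset\mathbb{R}^3$ be a knot, given by a $1$-periodic $C^1$ curve (in particular, $K$ may be smooth) with nowhere vanishing derivative which is injective on $[0,1)$, and suppose that its orthogonal projection to the $xy$-plane is regular, i.e. an immersed closed curve whose only multiple points are transverse double points (the crossings). Let $D$ be the resulting knot diagram, where the $z$-coordinate decides which branch passes over at a crossing. The strands of $D$ are the connected components of $K$ with its undercrossing points removed, and the regions of $D$ are the connected components of the complement in $\mathbb{R}^2$ of the projection of $K$. For a natural number $n$, an $n$-coloring of $D$ assigns to each strand an element of $\mathbb{Z}/n\mathbb{Z}$ such that $x+z=2y$ at each crossing, where $y$ is the color of the overstrand and $x,z$ are the colors of the two understrands. For regions $R,S$ of $D$, a generic arc from $R$ to $S$ is an injective continuous map $\alpha:[0,1]\to\mathbb{R}^2$ with $\alpha(0)\in R$ and $\alpha(1)\in S$ which does not pass through a crossing and which, at each time when it meets $D$, is differentiable and transverse to $D$. Claim. Fix an $n$-coloring of $D$. Then every generic arc meets $D$ only finitely many times; for any two (possibly equal) regions $R,S$ of $D$ there is a generic arc from $R$ to $S$; and the alternating sum $c_1-c_2+c_3-\cdots\pm c_k\in\mathbb{Z}/n\mathbb{Z}$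 of the colors $c_1,\dots,c_k$ of the strands that such an arc crosses, in the order in which it crosses them, does not depend on the arc, but only on $R$ and $S$. In other words, there is a unique function $d$ which assigns to each pair of regions $(R,S)$ an element $d(R,S)\in\mathbb{Z}/n\mathbb{Z}$ equal to this alternating sum for every generic arc from $R$ to $S$. -/

import Mathlib

open Set Filter Topology

noncomputable section

namespace KnotColoring

/-- Euclidean space `ℝ³`. -/
abbrev Space := EuclideanSpace ℝ (Fin 3)

/-- The `xy`-plane `ℝ²`. -/
abbrev Plane := EuclideanSpace ℝ (Fin 2)

/-- Orthogonal projection along the `z`-axis to the `xy`-plane. -/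
def proj (p : Space) : Plane := !₂[p 0, p 1]

/-- A knot: an embedding of the circle `ℝ / ℤ` in `ℝ³`, given as a `1`-periodic curve which is
continuously differentiable with nowhere vanishing velocity and injective on a period. -/
structure Knot where
  /-- the parametrization -/
  curve : ℝ → Space
  periodic : Function.Periodic curve 1
  contDiff : ContDiff ℝ 1 curve
  deriv_ne_zero : ∀ t, deriv curve t ≠ 0
  injOn : InjOn curve (Ico 0 1)

/-- The planar curve obtained by projecting the knot. -/
def Knot.shadow (K : Knot) (t : ℝ) : Plane := proj (K.curve t)

/-- A knot diagram: a knot whose projection is regular, that is, an immersed plane curve whose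
only multiple points are transverse double points. The over/under information at a double point is
given by the `z`-coordinate. -/
structure KnotDiagram extends Knot where
  immersed : ∀ t, deriv toKnot.shadow t ≠ 0
  transverse : ∀ s t, curve s ≠ curve t → toKnot.shadow s = toKnot.shadow t →
    LinearIndependent ℝ ![deriv toKnot.shadow s, deriv toKnot.shadow t]
  no_triple : ∀ r s t, toKnot.shadow r = toKnot.shadow s → toKnot.shadow s = toKnot.shadow t →
    curve r = curve s ∨ curve s = curve t ∨ curve r = curve t

namespace KnotDiagram

variable (D : KnotDiagram)

/-- The underlying subset of the plane. -/
def trace : Set Plane := range D.shadow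

/-- The double points of the diagram. -/
def IsCrossing (w : Plane) : Prop :=
  ∃ s t, D.curve s ≠ D.curve t ∧ D.shadow s = w ∧ D.shadow t = w

/-- At parameters `s`, `t` the knot has a crossing, passing over at `s` and under at `t`. -/
def PassesOver (s t : ℝ) : Prop :=
  D.shadow s = D.shadow t ∧ D.curve t 2 < D.curve s 2

/-- The knot with its undercrossing points removed. -/
def visible : Set Space :=
  {p | ∃ s, D.curve s = p ∧ ∀ r, ¬ D.PassesOver r s}

/-- The strands of the diagram: the connected components of the knot cut at its undercrossings. -/
def Strand : Type :=
  {X : Set Space // ∃ p ∈ D.visible, X = connectedComponentIn D.visible p}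

/-- The regions of the diagram: the connected components of its complement in the plane. -/
def Region : Type :=
  {R : Set Plane // ∃ w ∈ D.traceᶜ, R = connectedComponentIn D.traceᶜ w}

/-- An `n`-coloring: an element of `ℤ/n` for each strand, such that at every crossing, if `Y` is
the overstrand, and `X`, `Z` are the understrands arriving at and leaving the crossing, then
`x + z = 2 y`. -/
structure Coloring (n : ℕ) where
  /-- the color of each strand -/
  color : D.Strand → ZMod n
  crossing : ∀ (s t : ℝ) (X Y Z : D.Strand), D.PassesOver s t → D.curve s ∈ Y.1 →
    (∀ᶠ u in 𝓝[<] t, D.curve u ∈ X.1) → (∀ᶠ u in 𝓝[>] t, D.curve u ∈ Z.1) →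
    color X + color Z = 2 * color Y

variable {D}

open Classical in
/-- The color of the strand through a point of the diagram (and `0` off the diagram); the strand is
unique, see `colorAt_eq`. -/
def Coloring.colorAt {n : ℕ} (c : D.Coloring n) (w : Plane) : ZMod n :=
  if h : ∃ X : D.Strand, w ∈ proj '' X.1 then c.color h.choose else 0

/-- At most one strand passes through a point of the plane. -/
theorem Strand.eq_of_mem {X Y : D.Strand} {w : Plane} (hX : w ∈ proj '' X.1)
    (hY : w ∈ proj '' Y.1) : X = Y := by
  obtain ⟨X, p, hp, rfl⟩ := X
  obtain ⟨Y, q, hq, rfl⟩ := Y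
  obtain ⟨a, ha, haw⟩ := hX
  obtain ⟨b, hb, hbw⟩ := hY
  have hab : a = b := by
    obtain ⟨s, rfl, hs⟩ := connectedComponentIn_subset _ _ ha
    obtain ⟨t, rfl, ht⟩ := connectedComponentIn_subset _ _ hb
    have hst : D.shadow s = D.shadow t := haw.trans hbw.symm
    have h2 : D.curve s 2 = D.curve t 2 := by
      by_contra hne
      rcases lt_or_gt_of_ne hne with h | h
      · exact hs t ⟨hst.symm, h⟩
      · exact ht s ⟨hst, h⟩
    have h0 := congrArg (fun v : Plane => v 0) hst
    have h1 := congrArg (fun v : Plane => v 1) hst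
    simp only [Knot.shadow, proj] at h0 h1
    ext i
    fin_cases i
    · simpa using h0
    · simpa using h1
    · exact h2
  subst hab
  apply Subtype.ext
  change connectedComponentIn _ p = connectedComponentIn _ q
  rw [connectedComponentIn_eq ha, connectedComponentIn_eq hb]

theorem Coloring.colorAt_eq {n : ℕ} (c : D.Coloring n) {w : Plane} {X : D.Strand}
    (hX : w ∈ proj '' X.1) : c.colorAt w = c.color X := by
  have h : ∃ X : D.Strand, w ∈ proj '' X.1 := ⟨X, hX⟩
  rw [Coloring.colorAt, dif_pos h, Strand.eq_of_mem h.choose_spec hX]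

variable (D)

/-- The times at which an arc `α : [0, 1] → ℝ²` meets the diagram. -/
def hitTimes (α : ℝ → Plane) : Set ℝ := {t ∈ Icc (0 : ℝ) 1 | α t ∈ D.trace}

/-- A generic oriented simple arc from the region `R` to the region `S`: it does not pass through a
crossing, and it meets the diagram transversely. -/
structure IsGenericArc (R S : D.Region) (α : ℝ → Plane) : Prop where
  continuousOn : ContinuousOn α (Icc 0 1)
  injOn : InjOn α (Icc 0 1)
  source : α 0 ∈ R.1
  target : α 1 ∈ S.1
  not_crossing : ∀ t ∈ D.hitTimes α, ¬ D.IsCrossing (α t)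
  differentiableAt : ∀ t ∈ D.hitTimes α, DifferentiableAt ℝ α t
  transverse : ∀ t ∈ D.hitTimes α, ∀ s, D.shadow s = α t →
    LinearIndependent ℝ ![deriv α t, deriv D.shadow s]

variable {D}

/-- The alternating sum, beginning with a positive sign, of the colors of the strands that the arc
`α` crosses, in the order in which it crosses them: the sign of the term at time `t` is `(-1) ^ k`
when `α` has met the diagram `k` times before. -/
def Coloring.altSum {n : ℕ} (c : D.Coloring n) (α : ℝ → Plane) : ZMod n :=
  ∑ᶠ t ∈ D.hitTimes α, (-1) ^ {s ∈ D.hitTimes α | s < t}.ncard * c.colorAt (α t)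

end KnotDiagram

end KnotColoring

end

/-!
Crossing a strand of color `c` is encoded by the reflection `v ↦ c - v` of `ℤ/n`. The alternating
sum `c₁ - c₂ + c₃ - ⋯ ± cₖ = c₁ - (c₂ - (c₃ - ⋯))` is the value at `0` of the product of the
reflections in `c₁, …, cₖ`, in this order, so no separate account of parities is needed. It
suffices to find a potential: a function `φ` with values in the permutations of `ℤ/n`, locally
constant off the diagram, which is multiplied on the left by the reflection in `c` whenever a strand
of color `c` is crossed, in either direction. Then the alternating sum along an arc `α` is
`φ (α 0) ((φ (α 1))⁻¹ 0)` (`IsGenericArc.altSum_eq`), and `φ` is constant on regions.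

A potential exists near each point. At a simple point the diagram is an embedded `C¹` arc with two
sides. At a crossing it is a pair of axes in a chart, and the relation `x + z = 2 y` says that the
product of the four reflections met on a turn around the crossing is trivial
(`Coloring.exists_isPotentialAt_of_passesOver`). Local potentials are unique up to right
multiplication by a constant, so they can be glued on every rectangle by subdivision
(`exists_flatAt_rect`). A rectangle is enough to compare two arcs, by compactness.

A generic arc meets the diagram in isolated points, hence finitely often. Generic arcs exist between
any two regions: by Sard's theorem for the functions `ℓ ∘ shadow`, with `ℓ` linear, almost every
segment in a given direction is transverse to the diagram and misses the finitely many crossings.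
-/

open Set Filter Topology

noncomputable section

namespace KnotColoring

/-! ### Gluing locally defined functions on rectangles -/

/-- A function which near each point of a preconnected set `A` is constant on `O` takes the same
value on `O` near all points of `A`. The set `A` need not lie in `O`, only in its closure. -/
theorem eventually_eq_of_isPreconnected {X Y : Type*} [TopologicalSpace X] {A O : Set X}
    (hA : IsPreconnected A) (hO : ∀ w ∈ A, (𝓝[O] w).NeBot) {M : X → Y}
    (hM : ∀ w ∈ A, ∃ m, ∀ᶠ x in 𝓝[O] w, M x = m) {w w' : X} (hw : w ∈ A) (hw' : w' ∈ A) {m : Y}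
    (h : ∀ᶠ x in 𝓝[O] w, M x = m) : ∀ᶠ x in 𝓝[O] w', M x = m := by
  have key : A ⊆ {v | ∀ᶠ x in 𝓝[O] v, M x = m} := by
    by_contra hsub
    obtain ⟨v, hvA, hv⟩ := not_subset.1 hsub
    obtain ⟨m', hm'⟩ := hM v hvA
    have hne : m' ≠ m := fun e => hv (e ▸ hm')
    obtain ⟨z, hzA, hz, m'', hne', hz'⟩ := hA {v | ∀ᶠ x in 𝓝[O] v, M x = m}
      {v | ∃ m', m' ≠ m ∧ ∀ᶠ x in 𝓝[O] v, M x = m'}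
      (isOpen_iff_mem_nhds.2 fun v hv => eventually_nhds_nhdsWithin.2 hv)
      (isOpen_iff_mem_nhds.2 fun v ⟨m', hm', hv⟩ => by
        filter_upwards [eventually_nhds_nhdsWithin.2 hv] with v' hv' using ⟨m', hm', hv'⟩)
      (fun v hv => by
        obtain ⟨m', h'⟩ := hM v hv
        by_cases e : m' = m
        exacts [Or.inl (e ▸ h'), Or.inr ⟨m', e, h'⟩])
      ⟨w, hw, h⟩ ⟨v, hvA, m', hne, hm'⟩
    have := hO z hzA
    obtain ⟨x, h1, h2⟩ := ((show ∀ᶠ x in 𝓝[O] z, M x = m from hz).and hz').exists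
    exact hne' (h2.symm.trans h1)
  exact key hw'

/-- A property of intervals which holds for the small ones and is inherited by a union of two
adjacent intervals holds for all of them. -/
theorem interval_induction {p : ℝ → ℝ → Prop}
    (hglue : ∀ a m b, a ≤ m → m ≤ b → p a m → p m b → p a b)
    (hloc : ∀ x, ∃ ε > 0, ∀ a b, x - ε < a → a ≤ b → b < x + ε → p a b) {a b : ℝ}
    (hab : a ≤ b) : p a b := by
  set S := {t ∈ Icc a b | p a t} with hS
  have haS : a ∈ S := by
    obtain ⟨ε, hε, h⟩ := hloc a
    exact ⟨⟨le_rfl, hab⟩, h a a (by linarith) le_rfl (by linarith)⟩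
  have hbdd : BddAbove S := ⟨b, fun t ht => ht.1.2⟩
  obtain ⟨ε, hε, h⟩ := hloc (sSup S)
  obtain ⟨t, ht, hts⟩ := exists_lt_of_lt_csSup ⟨a, haS⟩ (show sSup S - ε < sSup S by linarith)
  have hle : t ≤ sSup S := le_csSup hbdd ht
  have hsb : sSup S ≤ b := csSup_le ⟨a, haS⟩ fun t ht => ht.1.2
  have step : ∀ u, t ≤ u → u < sSup S + ε → p a u := fun u htu hu =>
    hglue a t u ht.1.1 htu ht.2 (h t u hts htu hu)
  have : b < sSup S + ε := by
    by_contra! hb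
    have : sSup S + ε / 2 ∈ S :=
      ⟨⟨by linarith [ht.1.1], by linarith⟩, step _ (by linarith) (by linarith)⟩
    linarith [le_csSup hbdd this]
  exact step b (hle.trans hsb) this

section Flat

variable {G : Type*} [Group G]

/-- Given a local model `μ w` for each point `w`, the function `φ` agrees near `w`, on the set `O`,
with a right translate of the model at `w`. -/
def FlatAt (O : Set Plane) (μ : Plane → Plane → G) (φ : Plane → G) (w : Plane) : Prop :=
  ∃ g, ∀ᶠ x in 𝓝[O] w, φ x = μ w x * g

/-- The closed rectangle `[a, b] × [c, d]`. -/
def rect (a b c d : ℝ) : Set Plane := {w | w 0 ∈ Icc a b ∧ w 1 ∈ Icc c d}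

theorem convex_rect (a b c d : ℝ) : Convex ℝ (rect a b c d) := by
  have h : ∀ i : Fin 2, ∀ a b : ℝ, Convex ℝ {w : Plane | w i ∈ Icc a b} := fun i a b =>
    (convex_Icc a b).linear_preimage (EuclideanSpace.proj (𝕜 := ℝ) i).toLinearMap
  exact (h 0 a b).inter (h 1 c d)

variable {O : Set Plane} {μ : Plane → Plane → G}

/-- Two functions on sets separated by a line `w i = m` differ on the connected intersection by a
constant; once this is corrected, they are glued along the line. -/
theorem exists_flatAt_union (hO : Dense O) {A B : Set Plane} {i : Fin 2} {m : ℝ}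
    (hA : ∀ w ∈ A, w i ≤ m) (hB : ∀ w ∈ B, m ≤ w i) (hAm : ∀ w ∈ A, w i = m → w ∈ B)
    (hBm : ∀ w ∈ B, w i = m → w ∈ A) (hAB : IsPreconnected (A ∩ B))
    (h₁ : ∃ φ, ∀ w ∈ A, FlatAt O μ φ w) (h₂ : ∃ φ, ∀ w ∈ B, FlatAt O μ φ w) :
    ∃ φ, ∀ w ∈ A ∪ B, FlatAt O μ φ w := by
  classical
  obtain ⟨φ, hφ⟩ := h₁
  obtain ⟨ψ, hψ⟩ := h₂
  have hne : ∀ w : Plane, (𝓝[O] w).NeBot := fun w => mem_closure_iff_nhdsWithin_neBot.1 (hO w)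
  have hM : ∀ w ∈ A ∩ B, ∃ g, ∀ᶠ x in 𝓝[O] w, (ψ x)⁻¹ * φ x = g := by
    rintro w ⟨hwA, hwB⟩
    obtain ⟨g, hg⟩ := hφ w hwA
    obtain ⟨k, hk⟩ := hψ w hwB
    refine ⟨k⁻¹ * g, ?_⟩
    filter_upwards [hg, hk] with x h1 h2
    rw [h1, h2]; group
  obtain ⟨g, hg⟩ : ∃ g, ∀ w ∈ A ∩ B, ∀ᶠ x in 𝓝[O] w, (ψ x)⁻¹ * φ x = g := by
    rcases (A ∩ B).eq_empty_or_nonempty with h | ⟨w, hw⟩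
    · exact ⟨1, by simp [h]⟩
    · obtain ⟨g, hg⟩ := hM w hw
      exact ⟨g, fun w' hw' =>
        eventually_eq_of_isPreconnected hAB (fun w _ => hne w) hM hw hw' hg⟩
  have hcont : Continuous fun w : Plane => w i := (EuclideanSpace.proj (𝕜 := ℝ) i).continuous
  refine ⟨fun x => if x i ≤ m then φ x else ψ x * g, fun w hw => ?_⟩
  rcases lt_trichotomy (w i) m with h | h | h
  · have hwA : w ∈ A := hw.resolve_right fun hwB => h.not_ge (hB w hwB)
    obtain ⟨k, hk⟩ := hφ w hwA
    refine ⟨k, ?_⟩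
    filter_upwards [hk, nhdsWithin_le_nhds (hcont.continuousAt.eventually_lt_const h)] with x h1 h2
    rw [if_pos h2.le, h1]
  · have hwA : w ∈ A := hw.elim id fun hwB => hBm w hwB h
    obtain ⟨k, hk⟩ := hφ w hwA
    refine ⟨k, ?_⟩
    filter_upwards [hk, hg w ⟨hwA, hAm w hwA h⟩] with x h1 h2
    rw [← h2, mul_inv_cancel_left, ite_self, h1]
  · have hwB : w ∈ B := hw.resolve_left fun hwA => h.not_ge (hA w hwA)
    obtain ⟨k, hk⟩ := hψ w hwB
    refine ⟨k * g, ?_⟩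
    filter_upwards [hk, nhdsWithin_le_nhds (hcont.continuousAt.eventually_const_lt h)] with x h1 h2
    rw [if_neg h2.not_ge, h1, mul_assoc]

/-- Local models which are compatible up to right translation glue on every rectangle: thin
horizontal strips are built from small rectangles, and are then stacked. -/
theorem exists_flatAt_rect (hO : Dense O) (hμ : ∀ w, ∀ᶠ w' in 𝓝 w, FlatAt O μ (μ w) w')
    {a b c d : ℝ} (hab : a ≤ b) (hcd : c ≤ d) : ∃ φ, ∀ w ∈ rect a b c d, FlatAt O μ φ w := by
  have mono : ∀ {A B : Set Plane}, A ⊆ B → (∃ φ, ∀ w ∈ B, FlatAt O μ φ w) →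
      ∃ φ, ∀ w ∈ A, FlatAt O μ φ w := fun h ⟨φ, hφ⟩ => ⟨φ, fun w hw => hφ w (h hw)⟩
  have hconn : ∀ a b c d a' b' c' d',
      IsPreconnected (rect a b c d ∩ rect a' b' c' d') := fun a b c d a' b' c' d' =>
    ((convex_rect a b c d).inter (convex_rect a' b' c' d')).isPreconnected
  refine interval_induction (p := fun c d => ∃ φ, ∀ w ∈ rect a b c d, FlatAt O μ φ w) ?_ ?_ hcd
  · intro c m d hcm hmd h1 h2
    refine mono ?_ (exists_flatAt_union (i := 1) (m := m) hO ?_ ?_ ?_ ?_ (hconn _ _ _ _ _ _ _ _)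
      h1 h2)
    · rintro w ⟨h0, h1⟩
      rcases le_total (w 1) m with h | h
      exacts [Or.inl ⟨h0, h1.1, h⟩, Or.inr ⟨h0, h, h1.2⟩]
    · exact fun w hw => hw.2.2
    · exact fun w hw => hw.2.1
    · exact fun w hw h => ⟨hw.1, h.ge, h.le.trans hmd⟩
    · exact fun w hw h => ⟨hw.1, hcm.trans h.ge, h.le⟩
  intro y
  refine interval_induction (p := fun a b => ∃ ε > 0, ∀ c d, y - ε < c → c ≤ d → d < y + ε →
    ∃ φ, ∀ w ∈ rect a b c d, FlatAt O μ φ w) ?_ ?_ hab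
  · rintro a m b ham hmb ⟨ε, hε, h1⟩ ⟨δ, hδ, h2⟩
    refine ⟨min ε δ, lt_min hε hδ, fun c d hc hcd hd => ?_⟩
    have e1 := min_le_left ε δ
    have e2 := min_le_right ε δ
    refine mono ?_ (exists_flatAt_union (i := 0) (m := m) hO ?_ ?_ ?_ ?_ (hconn _ _ _ _ _ _ _ _)
      (h1 c d (by linarith) hcd (by linarith)) (h2 c d (by linarith) hcd (by linarith)))
    · rintro w ⟨h0, h1⟩
      rcases le_total (w 0) m with h | h
      exacts [Or.inl ⟨⟨h0.1, h⟩, h1⟩, Or.inr ⟨⟨h, h0.2⟩, h1⟩]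
    · exact fun w hw => hw.1.2
    · exact fun w hw => hw.1.1
    · exact fun w hw h => ⟨⟨h.ge, h.le.trans hmb⟩, hw.2⟩
    · exact fun w hw h => ⟨⟨ham.trans h.ge, h.le⟩, hw.2⟩
  · intro x
    obtain ⟨ε, hε, h⟩ := Metric.eventually_nhds_iff.1 (hμ !₂[x, y])
    refine ⟨ε / 2, by positivity, fun a b ha _ hb => ⟨ε / 2, by positivity, fun c d hc _ hd =>
      ⟨μ !₂[x, y], fun w hw => h ?_⟩⟩⟩
    rw [EuclideanSpace.dist_eq, Fin.sum_univ_two, Real.sqrt_lt' hε]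
    have h0 : |w 0 - x| < ε / 2 := abs_lt.2 ⟨by linarith [hw.1.1], by linarith [hw.1.2]⟩
    have h1 : |w 1 - y| < ε / 2 := abs_lt.2 ⟨by linarith [hw.2.1], by linarith [hw.2.2]⟩
    simp only [Real.dist_eq, Matrix.cons_val_zero, Matrix.cons_val_one]
    nlinarith [abs_nonneg (w 0 - x), abs_nonneg (w 1 - y)]

end Flat

/-! ### Local structure of a diagram -/

/-- Plane coordinates `f`, `g` near a common point `a s = b t` of two curves, inverse to
`(u, v) ↦ a u + b v - a s`: the curve `a` is the axis `g = t`, and `b` is the axis `f = s`. -/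
structure IsChart (a b : ℝ → Plane) (s t : ℝ) (f g : Plane → ℝ) : Prop where
  contDiffAt_fst : ContDiffAt ℝ 1 f (a s)
  contDiffAt_snd : ContDiffAt ℝ 1 g (a s)
  fst_eq : f (a s) = s
  snd_eq : g (a s) = t
  eventually_eq : ∀ᶠ x in 𝓝 (a s), a (f x) + b (g x) - a s = x
  eventually_left : ∀ᶠ u in 𝓝 s, f (a u) = u ∧ g (a u) = t
  eventually_right : ∀ᶠ v in 𝓝 t, f (b v) = s ∧ g (b v) = v

theorem exists_isChart {a b : ℝ → Plane} (ha : ContDiff ℝ 1 a) (hb : ContDiff ℝ 1 b) {s t : ℝ}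
    (hst : a s = b t) (hl : LinearIndependent ℝ ![deriv a s, deriv b t]) :
    ∃ f g, IsChart a b s t f g := by
  let Ψ : ℝ × ℝ → Plane := fun p => a p.1 + b p.2 - a s
  have hΨ : ContDiff ℝ 1 Ψ := by fun_prop
  let L : ℝ × ℝ →ₗ[ℝ] Plane :=
    (LinearMap.toSpanSingleton ℝ Plane (deriv a s)).coprod
      (LinearMap.toSpanSingleton ℝ Plane (deriv b t))
  have hL : Function.Injective L := by
    rw [injective_iff_map_eq_zero]
    rintro ⟨p, q⟩ h
    obtain ⟨h1, h2⟩ := LinearIndependent.pair_iff.1 hl p q (by simpa [L] using h)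
    simp [h1, h2]
  let e : (ℝ × ℝ) ≃L[ℝ] Plane :=
    (LinearEquiv.ofInjectiveOfFinrankEq L hL (by simp)).toContinuousLinearEquiv
  have hda : HasDerivAt a (deriv a s) s := (ha.differentiable (by simp) s).hasDerivAt
  have hdb : HasDerivAt b (deriv b t) t := (hb.differentiable (by simp) t).hasDerivAt
  have hd : HasFDerivAt Ψ (e : ℝ × ℝ →L[ℝ] Plane) (s, t) := by
    have h1 : HasFDerivAt (fun p : ℝ × ℝ => a p.1) _ (s, t) :=
      hda.hasFDerivAt.comp (s, t) hasFDerivAt_fst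
    have h2 : HasFDerivAt (fun p : ℝ × ℝ => b p.2) _ (s, t) :=
      hdb.hasFDerivAt.comp (s, t) hasFDerivAt_snd
    refine ((h1.add h2).sub_const (a s)).congr_fderiv ?_
    have he : ∀ p, e p = L p := fun _ => rfl
    refine ContinuousLinearMap.ext fun p => ?_
    rw [ContinuousLinearEquiv.coe_coe, he]
    simp [L]
  have hc : ContDiffAt ℝ 1 Ψ (s, t) := hΨ.contDiffAt
  have hw : Ψ (s, t) = a s := by simp [Ψ, hst]
  let φ := hc.localInverse hd (by simp)
  have hφ : ContDiffAt ℝ 1 φ (a s) := hw ▸ hc.to_localInverse hd (by simp)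
  have hs := hc.hasStrictFDerivAt' hd (by simp)
  have hr : ∀ᶠ y in 𝓝 (a s), Ψ (φ y) = y := hw ▸ hs.eventually_right_inverse
  have hi : ∀ᶠ p in 𝓝 (s, t), φ (Ψ p) = p := hs.eventually_left_inverse
  have h0 : φ (a s) = (s, t) := hw ▸ hi.self_of_nhds
  refine ⟨fun x => (φ x).1, fun x => (φ x).2, contDiff_fst.contDiffAt.comp _ hφ,
    contDiff_snd.contDiffAt.comp _ hφ, by simp [h0], by simp [h0], hr, ?_, ?_⟩
  · have := (Continuous.prodMk_left t).continuousAt (x := s) |>.eventually hi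
    filter_upwards [this] with u hu
    have : Ψ (u, t) = a u := by simp [Ψ, hst]
    simp [this] at hu
    simp [hu]
  · have := (Continuous.prodMk_right s).continuousAt (x := t) |>.eventually hi
    filter_upwards [this] with v hv
    have : Ψ (s, v) = b v := by simp [Ψ]
    simp [this] at hv
    simp [hv]

theorem fderiv_ne_zero_of_eventually_eq {k : Plane → ℝ} {a : ℝ → Plane} {s : ℝ}
    (hk : ContDiffAt ℝ 1 k (a s)) (ha : ContDiff ℝ 1 a) (h : ∀ᶠ u in 𝓝 s, k (a u) = u) :
    fderiv ℝ k (a s) ≠ 0 := by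
  intro h0
  have h1 := (hk.differentiableAt (by simp)).hasFDerivAt.comp_hasDerivAt s
    (ha.differentiable (by simp) s).hasDerivAt
  have h2 := (h1.congr_of_eventuallyEq (f₁ := id) (h.mono fun u hu => hu.symm)).unique
    (hasDerivAt_id s)
  simp [h0] at h2

namespace KnotDiagram

variable (D : KnotDiagram)

theorem curve_eq_iff {s t : ℝ} : D.curve s = D.curve t ↔ ∃ k : ℤ, s = t + k := by
  have hf : ∀ r, D.curve (Int.fract r) = D.curve r := fun r => by
    have := D.periodic.sub_int_mul_eq ⌊r⌋ (x := r)
    rwa [mul_one] at this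
  constructor
  · intro h
    have := D.injOn ⟨Int.fract_nonneg s, Int.fract_lt_one s⟩
      ⟨Int.fract_nonneg t, Int.fract_lt_one t⟩ (by rw [hf, hf, h])
    exact ⟨⌊s⌋ - ⌊t⌋, by push_cast; linarith [Int.fract_add_floor s, Int.fract_add_floor t]⟩
  · rintro ⟨k, rfl⟩
    simpa using D.periodic.int_mul k t

theorem shadow_eq_of_curve_eq {s t : ℝ} (h : D.curve s = D.curve t) : D.shadow s = D.shadow t :=
  congrArg proj h

theorem contDiff_shadow : ContDiff ℝ 1 D.shadow := by
  have h : ∀ i, ContDiff ℝ 1 fun t => D.curve t i := fun i =>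
    (EuclideanSpace.proj (𝕜 := ℝ) i).contDiff.comp D.contDiff
  refine contDiff_euclidean.2 fun i => ?_
  fin_cases i
  · simpa [Knot.shadow, proj] using h 0
  · simpa [Knot.shadow, proj] using h 1

theorem continuous_shadow : Continuous D.shadow := D.contDiff_shadow.continuous

theorem hasDerivAt_shadow (s : ℝ) : HasDerivAt D.shadow (deriv D.shadow s) s :=
  (D.contDiff_shadow.differentiable (by simp) s).hasDerivAt

theorem exists_curve_eq_mem_Icc (r : ℝ) : ∃ u ∈ Icc (0 : ℝ) 1, D.curve u = D.curve r :=
  ⟨Int.fract r, ⟨Int.fract_nonneg r, (Int.fract_lt_one r).le⟩,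
    D.curve_eq_iff.2 ⟨-⌊r⌋, by push_cast; linarith [Int.fract_add_floor r]⟩⟩

theorem isCompact_trace : IsCompact D.trace := by
  have : D.trace = D.shadow '' Icc 0 1 := by
    refine (image_subset_range _ _).antisymm' ?_
    rintro _ ⟨r, rfl⟩
    obtain ⟨u, hu, h⟩ := D.exists_curve_eq_mem_Icc r
    exact ⟨u, hu, D.shadow_eq_of_curve_eq h⟩
  exact this ▸ isCompact_Icc.image D.continuous_shadow

theorem dense_compl_trace : Dense D.traceᶜ :=
  D.contDiff_shadow.dense_compl_range_of_finrank_lt_finrank (by simp)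

/-- If `U` is a neighborhood of all parameters of the points of the knot over `w`, up to the period,
then `U` parametrizes all of the knot over a neighborhood of `w`. -/
theorem eventually_exists_mem_of_shadow_eq {w : Plane} {U : Set ℝ}
    (hU : ∀ r, D.shadow r = w → ∃ t, D.curve r = D.curve t ∧ U ∈ 𝓝 t) :
    ∀ᶠ x in 𝓝 w, ∀ r, D.shadow r = x → ∃ u ∈ U, D.curve u = D.curve r := by
  let C : Set ℝ := Icc 0 1 ∩ ⋂ k : ℤ, {r | r + k ∉ interior U}
  have hC : IsCompact C := isCompact_Icc.inter_right <| isClosed_iInter fun k =>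
    (isOpen_interior.preimage (continuous_add_const (k : ℝ))).isClosed_compl
  have hw : w ∉ D.shadow '' C := by
    rintro ⟨r, ⟨-, hr⟩, hrw⟩
    obtain ⟨t, ht, htU⟩ := hU r hrw
    obtain ⟨k, rfl⟩ := D.curve_eq_iff.1 ht.symm
    exact mem_iInter.1 hr k (mem_interior_iff_mem_nhds.2 htU)
  filter_upwards [(hC.image D.continuous_shadow).isClosed.isOpen_compl.mem_nhds hw] with x hx r hr
  obtain ⟨u, hu, hur⟩ := D.exists_curve_eq_mem_Icc r
  by_contra! hcon
  refine hx ⟨u, ⟨hu, mem_iInter.2 fun k hk => ?_⟩, (D.shadow_eq_of_curve_eq hur).trans hr⟩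
  exact hcon (u + k) (interior_subset hk) ((D.curve_eq_iff.2 ⟨k, rfl⟩).trans hur)

/-- Near `w` the function `k` is `C¹` and vanishes on the diagram, and its derivative at `w` is not
zero. At a simple point of the diagram, the sign of `k` then tells the two sides apart. -/
structure IsSide (k : Plane → ℝ) (w : Plane) : Prop where
  contDiffAt : ContDiffAt ℝ 1 k w
  fderiv_ne_zero : fderiv ℝ k w ≠ 0
  eventually_eq_zero : ∀ᶠ x in 𝓝 w, x ∈ D.trace → k x = 0

theorem exists_linearIndependent {v : Plane} (hv : v ≠ 0) :
    ∃ n : Plane, LinearIndependent ℝ ![v, n] := by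
  refine ⟨!₂[-v 1, v 0], ?_⟩
  rw [LinearIndependent.pair_iff]
  intro p q h
  have h0 := congrArg (fun x : Plane => x 0) h
  have h1 := congrArg (fun x : Plane => x 1) h
  simp at h0 h1
  have hpos : 0 < v 0 ^ 2 + v 1 ^ 2 := by
    by_contra! hle
    apply hv
    ext i
    fin_cases i
    · simp; nlinarith [sq_nonneg (v 0), sq_nonneg (v 1)]
    · simp; nlinarith [sq_nonneg (v 0), sq_nonneg (v 1)]
  constructor
  · have : p * (v 0 ^ 2 + v 1 ^ 2) = 0 := by linear_combination v 0 * h0 + v 1 * h1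
    exact (mul_eq_zero.1 this).resolve_right hpos.ne'
  · have : q * (v 0 ^ 2 + v 1 ^ 2) = 0 := by linear_combination v 0 * h1 - v 1 * h0
    exact (mul_eq_zero.1 this).resolve_right hpos.ne'

variable {D}

/-- Near a point which is not a crossing, the diagram is the axis `g = 0` of a chart whose second
family of coordinate lines has a direction `n` transverse to the diagram. -/
theorem exists_isChart_of_not_isCrossing {s : ℝ} (hs : ¬ D.IsCrossing (D.shadow s)) :
    ∃ (n : Plane) (f g : Plane → ℝ), IsChart D.shadow (fun v => D.shadow s + v • n) s 0 f g ∧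
      LinearIndependent ℝ ![deriv D.shadow s, n] ∧
      ∀ U ∈ 𝓝 s, ∀ᶠ x in 𝓝 (D.shadow s), ∀ r, D.shadow r = x →
        ∃ u ∈ U, D.curve u = D.curve r ∧ f x = u ∧ g x = 0 := by
  obtain ⟨n, hn⟩ := exists_linearIndependent (D.immersed s)
  have hd : deriv (fun v : ℝ => D.shadow s + v • n) 0 = n := by
    have : HasDerivAt (fun v : ℝ => D.shadow s + v • n) ((1 : ℝ) • n) 0 :=
      ((hasDerivAt_id (0 : ℝ)).smul_const n).const_add _
    simpa using this.deriv
  obtain ⟨f, g, h⟩ := exists_isChart D.contDiff_shadow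
    (b := fun v => D.shadow s + v • n) (by fun_prop) (s := s) (t := 0) (by simp)
    (by rw [hd]; exact hn)
  refine ⟨n, f, g, h, hn, fun U hU => ?_⟩
  filter_upwards [D.eventually_exists_mem_of_shadow_eq (w := D.shadow s)
    (U := U ∩ {u | f (D.shadow u) = u ∧ g (D.shadow u) = 0}) fun r hr =>
    ⟨s, by_contra fun hne => hs ⟨r, s, hne, hr, rfl⟩, inter_mem hU h.eventually_left⟩]
    with x hx r hr
  obtain ⟨u, ⟨huU, hu1, hu2⟩, hur⟩ := hx r hr
  have e : D.shadow u = x := (D.shadow_eq_of_curve_eq hur).trans hr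
  exact ⟨u, huU, hur, e ▸ hu1, e ▸ hu2⟩

theorem IsChart.isSide {s : ℝ} {n : Plane} {f g : Plane → ℝ}
    (h : IsChart D.shadow (fun v => D.shadow s + v • n) s 0 f g)
    (hU : ∀ U ∈ 𝓝 s, ∀ᶠ x in 𝓝 (D.shadow s), ∀ r, D.shadow r = x →
        ∃ u ∈ U, D.curve u = D.curve r ∧ f x = u ∧ g x = 0) : D.IsSide g (D.shadow s) := by
  refine ⟨h.contDiffAt_snd, ?_, ?_⟩
  · have := fderiv_ne_zero_of_eventually_eq (k := g) (a := fun v => D.shadow s + v • n) (s := 0)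
      (by simpa using h.contDiffAt_snd) (by fun_prop) (h.eventually_right.mono fun v hv => hv.2)
    simpa using this
  · filter_upwards [hU univ univ_mem] with x hx
    rintro ⟨r, hr⟩
    obtain ⟨u, -, -, -, h⟩ := hx r hr
    exact h

theorem eventually_not_isCrossing {w : Plane} (hw : ¬ D.IsCrossing w) :
    ∀ᶠ x in 𝓝 w, ¬ D.IsCrossing x := by
  by_cases hD : w ∈ D.trace
  · obtain ⟨s, rfl⟩ := hD
    obtain ⟨n, f, g, h, -, hU⟩ := exists_isChart_of_not_isCrossing hw
    filter_upwards [hU univ univ_mem] with x hx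
    rintro ⟨r, r', hne, hr, hr'⟩
    obtain ⟨u, -, hu, hfu, -⟩ := hx r hr
    obtain ⟨u', -, hu', hfu', -⟩ := hx r' hr'
    exact hne (by rw [← hu, ← hu', ← hfu, ← hfu'])
  · filter_upwards [D.isCompact_trace.isClosed.isOpen_compl.mem_nhds hD] with x hx
    rintro ⟨r, -, -, hr, -⟩
    exact hx ⟨r, hr⟩

theorem IsSide.fderiv_deriv_shadow {k : Plane → ℝ} {s : ℝ} (hk : D.IsSide k (D.shadow s)) :
    fderiv ℝ k (D.shadow s) (deriv D.shadow s) = 0 := by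
  have h1 := (hk.contDiffAt.differentiableAt (by simp)).hasFDerivAt.comp_hasDerivAt s
    (D.hasDerivAt_shadow s)
  have h2 : (fun _ : ℝ => (0 : ℝ)) =ᶠ[𝓝 s] k ∘ D.shadow := by
    filter_upwards [D.continuous_shadow.continuousAt.eventually hk.eventually_eq_zero] with u hu
    exact (hu ⟨u, rfl⟩).symm
  exact (h1.congr_of_eventuallyEq h2).unique (hasDerivAt_const s 0)

theorem IsSide.fderiv_ne_zero_of_linearIndependent {k : Plane → ℝ} {s : ℝ}
    (hk : D.IsSide k (D.shadow s)) {n : Plane} (hn : LinearIndependent ℝ ![deriv D.shadow s, n]) :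
    fderiv ℝ k (D.shadow s) n ≠ 0 := by
  intro h0
  apply hk.fderiv_ne_zero
  have hspan := hn.span_eq_top_of_card_eq_finrank' (by simp)
  ext x
  have hx : x ∈ Submodule.span ℝ (range ![deriv D.shadow s, n]) := hspan ▸ Submodule.mem_top
  simp only [Matrix.range_cons, Matrix.range_empty, union_empty, singleton_union] at hx
  obtain ⟨p, q, rfl⟩ := Submodule.mem_span_pair.1 hx
  simp [h0, hk.fderiv_deriv_shadow]

/-- At a simple point there is a side function, and every side function has the same sign as it off
the diagram, or the opposite sign. It is the second coordinate `g` of the chart: a point near `w`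
is `shadow u + g • n`, so a side function `k` is there close to `g` times the derivative of `k`
along `n`. -/
theorem exists_isSide {w : Plane} (hw : w ∈ D.trace) (hc : ¬ D.IsCrossing w) :
    ∃ g, D.IsSide g w ∧ ∀ k, D.IsSide k w →
      (∀ᶠ x in 𝓝[D.traceᶜ] w, k x ≠ 0 ∧ (0 < k x ↔ 0 < g x)) ∨
      (∀ᶠ x in 𝓝[D.traceᶜ] w, k x ≠ 0 ∧ (0 < k x ↔ ¬ 0 < g x)) := by
  obtain ⟨s, rfl⟩ := hw
  obtain ⟨n, f, g, h, hn, hU⟩ := exists_isChart_of_not_isCrossing hc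
  refine ⟨g, IsChart.isSide h hU, fun k hk => ?_⟩
  have hkn := hk.fderiv_ne_zero_of_linearIndependent hn
  set δ := fderiv ℝ k (D.shadow s) n with hδ
  have hn0 : 0 < ‖n‖ := norm_pos_iff.2 fun h0 => hkn (by simp [hδ, h0])
  have hstrict := (hk.contDiffAt.hasStrictFDerivAt (by simp)).isLittleO
  have hc : 0 < |δ| / (2 * ‖n‖) := by positivity
  have hfc : ContinuousAt f (D.shadow s) := h.contDiffAt_fst.continuousAt
  have htend : Tendsto (fun x => (x, D.shadow (f x))) (𝓝 (D.shadow s))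
      (𝓝 (D.shadow s, D.shadow s)) := by
    have : ContinuousAt (fun x => (x, D.shadow (f x))) (D.shadow s) :=
      continuousAt_id.prodMk (D.continuous_shadow.continuousAt.comp hfc)
    simpa [ContinuousAt, h.fst_eq] using this
  have hk0 : ∀ᶠ x in 𝓝 (D.shadow s), k (D.shadow (f x)) = 0 := by
    have : ContinuousAt (fun x => D.shadow (f x)) (D.shadow s) :=
      D.continuous_shadow.continuousAt.comp hfc
    have h' := hk.eventually_eq_zero
    rw [ContinuousAt, h.fst_eq] at this
    exact (this.eventually h').mono fun x hx => hx ⟨_, rfl⟩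
  have key : ∀ᶠ x in 𝓝[D.traceᶜ] (D.shadow s), g x ≠ 0 ∧ |k x - g x * δ| ≤ |g x| * |δ| / 2 := by
    filter_upwards [nhdsWithin_le_nhds (htend.eventually (hstrict.def hc)),
      nhdsWithin_le_nhds hk0, nhdsWithin_le_nhds h.eventually_eq, self_mem_nhdsWithin]
      with x h1 h2 h3 hx
    have h4 : x - D.shadow (f x) = g x • n := by
      rw [sub_eq_iff_eq_add]
      nth_rewrite 1 [← h3]
      abel
    refine ⟨fun h0 => hx ⟨f x, ?_⟩, ?_⟩
    · rw [h0, zero_smul, sub_eq_zero] at h4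
      exact h4.symm
    · simp only [h4, h2, map_smul, sub_zero, norm_smul, Real.norm_eq_abs, smul_eq_mul] at h1
      refine h1.trans (le_of_eq ?_)
      field_simp
  rcases lt_or_gt_of_ne hkn with hneg | hpos
  · right
    filter_upwards [key] with x ⟨h0, h1⟩
    rw [abs_le, abs_of_neg hneg] at h1
    rcases lt_or_gt_of_ne h0 with hx | hx
    · rw [abs_of_neg hx] at h1
      have : 0 < k x := by nlinarith [mul_pos_of_neg_of_neg hx hneg]
      exact ⟨this.ne', by simp [this, hx.le]⟩
    · rw [abs_of_pos hx] at h1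
      have : k x < 0 := by nlinarith [mul_pos hx (neg_pos.2 hneg)]
      exact ⟨this.ne, by simp [this.le, hx]⟩
  · left
    filter_upwards [key] with x ⟨h0, h1⟩
    rw [abs_le, abs_of_pos hpos] at h1
    rcases lt_or_gt_of_ne h0 with hx | hx
    · rw [abs_of_neg hx] at h1
      have : k x < 0 := by nlinarith [mul_pos (neg_pos.2 hx) hpos]
      exact ⟨this.ne, iff_of_false this.not_gt hx.not_gt⟩
    · rw [abs_of_pos hx] at h1
      have : 0 < k x := by nlinarith [mul_pos hx hpos]
      exact ⟨this.ne', by simp [this, hx]⟩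

end KnotDiagram

/-! ### Potentials of a coloring -/

theorem eventually_contDiffAt_and_fderiv_ne_zero {k : Plane → ℝ} {w : Plane}
    (hk : ContDiffAt ℝ 1 k w) (h : fderiv ℝ k w ≠ 0) :
    ∀ᶠ x in 𝓝 w, ContDiffAt ℝ 1 k x ∧ fderiv ℝ k x ≠ 0 :=
  (hk.eventually (by simp)).and
    ((hk.fderiv_right (m := 0) (by simp)).continuousAt.eventually_ne h)

/-- The reflection `v ↦ c - v` of `ℤ/n`. -/
def reflection {n : ℕ} (c : ZMod n) : Equiv.Perm (ZMod n) := Equiv.subLeft c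

@[simp] theorem reflection_apply {n : ℕ} (c v : ZMod n) : reflection c v = c - v := rfl

theorem reflection_mul_self {n : ℕ} (c : ZMod n) : reflection c * reflection c = 1 := by
  ext v; simp

/-- The crossing relation of a coloring, in terms of reflections. -/
theorem reflection_conj {n : ℕ} {x y z : ZMod n} (h : x + z = 2 * y) :
    reflection y * (reflection x * reflection y) = reflection z := by
  ext v
  simp only [Equiv.Perm.mul_apply, reflection_apply]
  linear_combination -h

namespace KnotDiagram

variable {D : KnotDiagram} {n : ℕ}

theorem IsSide.eventually {k : Plane → ℝ} {w : Plane} (h : D.IsSide k w) :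
    ∀ᶠ x in 𝓝 w, D.IsSide k x := by
  filter_upwards [eventually_contDiffAt_and_fderiv_ne_zero h.contDiffAt h.fderiv_ne_zero,
    eventually_eventually_nhds.2 h.eventually_eq_zero] with x h1 h2 using ⟨h1.1, h1.2, h2⟩

theorem IsSide.eventually_ne_zero {k : Plane → ℝ} {w : Plane} (h : D.IsSide k w)
    (hw : w ∈ D.trace) (hc : ¬ D.IsCrossing w) : ∀ᶠ x in 𝓝[D.traceᶜ] w, k x ≠ 0 := by
  obtain ⟨g, -, hg⟩ := exists_isSide hw hc
  exact (hg k h).elim (fun h => h.mono fun x hx => hx.1) fun h => h.mono fun x hx => hx.1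

theorem IsSide.pos_iff {k k' : Plane → ℝ} {w : Plane} (h : D.IsSide k w) (h' : D.IsSide k' w)
    (hw : w ∈ D.trace) (hc : ¬ D.IsCrossing w) :
    (∀ᶠ x in 𝓝[D.traceᶜ] w, (0 < k x ↔ 0 < k' x)) ∨
      (∀ᶠ x in 𝓝[D.traceᶜ] w, (0 < k x ↔ ¬ 0 < k' x)) := by
  obtain ⟨g, -, hg⟩ := exists_isSide hw hc
  rcases hg k h with h1 | h1 <;> rcases hg k' h' with h2 | h2
  · exact Or.inl (by filter_upwards [h1, h2] with x a b using by tauto)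
  · exact Or.inr (by filter_upwards [h1, h2] with x a b using by tauto)
  · exact Or.inr (by filter_upwards [h1, h2] with x a b using by tauto)
  · exact Or.inl (by filter_upwards [h1, h2] with x a b using by tauto)

theorem curve_eq_of_height_eq {s t : ℝ} (h : D.shadow s = D.shadow t)
    (h2 : D.curve s 2 = D.curve t 2) : D.curve s = D.curve t := by
  have h0 := congrArg (fun v : Plane => v 0) h
  have h1 := congrArg (fun v : Plane => v 1) h
  simp only [Knot.shadow, proj] at h0 h1
  ext i
  fin_cases i
  · simpa using h0
  · simpa using h1
  · exact h2

theorem IsCrossing.exists_passesOver {w : Plane} (h : D.IsCrossing w) :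
    ∃ s t, D.PassesOver s t ∧ D.shadow s = w := by
  obtain ⟨s, t, hne, hs, ht⟩ := h
  have hst : D.shadow s = D.shadow t := hs.trans ht.symm
  rcases lt_or_gt_of_ne (fun h2 => hne (curve_eq_of_height_eq hst h2)) with h | h
  · exact ⟨t, s, ⟨hst.symm, h⟩, ht⟩
  · exact ⟨s, t, ⟨hst, h⟩, hs⟩

theorem PassesOver.curve_ne {s t : ℝ} (h : D.PassesOver s t) : D.curve s ≠ D.curve t :=
  fun he => h.2.ne' (by rw [he])

theorem curve_mem_visible {s : ℝ} (h : ¬ D.IsCrossing (D.shadow s)) : D.curve s ∈ D.visible :=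
  ⟨s, rfl, fun r hr => h ⟨r, s, hr.curve_ne, hr.1, rfl⟩⟩

theorem PassesOver.curve_mem_visible {s t : ℝ} (h : D.PassesOver s t) :
    D.curve s ∈ D.visible := by
  refine ⟨s, rfl, fun r hr => ?_⟩
  rcases D.no_triple r s t hr.1 h.1 with e | e | e
  · exact hr.curve_ne e
  · exact h.curve_ne e
  · have h1 := h.2
    have h2 := hr.2
    rw [e] at h2
    exact lt_asymm h1 h2

theorem exists_strand {I : Set ℝ} (hI : IsPreconnected I) (hne : I.Nonempty)
    (h : ∀ u ∈ I, D.curve u ∈ D.visible) : ∃ X : D.Strand, ∀ u ∈ I, D.curve u ∈ X.1 := by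
  obtain ⟨u₀, h₀⟩ := hne
  refine ⟨⟨_, D.curve u₀, h u₀ h₀, rfl⟩, fun u hu => ?_⟩
  exact (hI.image _ D.contDiff.continuous.continuousOn).subset_connectedComponentIn
    (mem_image_of_mem _ h₀) (image_subset_iff.2 (show I ⊆ D.curve ⁻¹' D.visible from h))
    (mem_image_of_mem _ hu)

theorem Coloring.colorAt_shadow (c : D.Coloring n) {X : D.Strand} {u : ℝ} (h : D.curve u ∈ X.1) :
    c.colorAt (D.shadow u) = c.color X :=
  c.colorAt_eq ⟨_, h, rfl⟩

theorem Coloring.eventually_colorAt_eq (c : D.Coloring n) {w : Plane} (hc : ¬ D.IsCrossing w) :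
    ∀ᶠ x in 𝓝 w, x ∈ D.trace → w ∈ D.trace → c.colorAt x = c.colorAt w := by
  by_cases hw : w ∈ D.trace
  swap
  · exact Eventually.of_forall fun x _ h => absurd h hw
  obtain ⟨s, rfl⟩ := hw
  obtain ⟨ε, hε, h⟩ := Metric.eventually_nhds_iff_ball.1
    (D.continuous_shadow.continuousAt.eventually (eventually_not_isCrossing hc))
  obtain ⟨X, hX⟩ := exists_strand (D := D) (convex_ball s ε).isPreconnected
    ⟨s, Metric.mem_ball_self hε⟩ fun u hu => curve_mem_visible (h u hu)
  filter_upwards [D.eventually_exists_mem_of_shadow_eq (w := D.shadow s)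
    (U := Metric.ball s ε) fun r hr =>
      ⟨s, by_contra fun hne => hc ⟨r, s, hne, hr, rfl⟩, Metric.ball_mem_nhds s hε⟩] with x hx
  rintro ⟨r, hr⟩ -
  obtain ⟨u, hu, hur⟩ := hx r hr
  rw [← hr, ← D.shadow_eq_of_curve_eq hur, c.colorAt_shadow (hX u hu),
    c.colorAt_shadow (hX s (Metric.mem_ball_self hε))]

/-- A potential near `w`, with values in the permutations of `ℤ/n`: it is locally constant off the
diagram, and multiplied on the left by the reflection in the color of a strand when this strand is
crossed. The values on the diagram do not matter. The notion is meant for points `w` which are not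
crossings; nothing has to be required at a crossing itself. -/
structure Coloring.IsPotentialAt (c : D.Coloring n) (φ : Plane → Equiv.Perm (ZMod n))
    (w : Plane) : Prop where
  eventually_eq : w ∉ D.trace → ∃ g, ∀ᶠ x in 𝓝 w, φ x = g
  exists_side : w ∈ D.trace → ∃ k, D.IsSide k w ∧ ∃ g, ∀ᶠ x in 𝓝[D.traceᶜ] w,
    φ x = if 0 < k x then reflection (c.colorAt w) * g else g

variable {c : D.Coloring n} {φ ψ : Plane → Equiv.Perm (ZMod n)} {w : Plane}

/-- The side function in the definition of a potential may be chosen freely: the two sides of the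
diagram play the same role, as reflections are involutions. -/
theorem Coloring.IsPotentialAt.eventually_eq_ite (h : c.IsPotentialAt φ w) (hw : w ∈ D.trace)
    (hc : ¬ D.IsCrossing w) {k : Plane → ℝ} (hk : D.IsSide k w) : ∃ g, ∀ᶠ x in 𝓝[D.traceᶜ] w,
      φ x = if 0 < k x then reflection (c.colorAt w) * g else g := by
  obtain ⟨k', hk', g, hg⟩ := h.exists_side hw
  rcases hk.pos_iff hk' hw hc with h1 | h1
  · refine ⟨g, ?_⟩
    filter_upwards [hg, h1] with x h2 h3
    simp [h2, h3]
  · refine ⟨reflection (c.colorAt w) * g, ?_⟩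
    filter_upwards [hg, h1] with x h2 h3
    rw [h2, ← mul_assoc, reflection_mul_self, one_mul]
    by_cases h4 : 0 < k' x <;> simp [h3, h4]

theorem Coloring.IsPotentialAt.mul_right (h : c.IsPotentialAt φ w)
    {g : Equiv.Perm (ZMod n)} (hψ : ∀ᶠ x in 𝓝[D.traceᶜ] w, ψ x = φ x * g) :
    c.IsPotentialAt ψ w := by
  refine ⟨fun hw => ?_, fun hw => ?_⟩
  · obtain ⟨k, hk⟩ := h.eventually_eq hw
    rw [D.isCompact_trace.isClosed.isOpen_compl.nhdsWithin_eq hw] at hψ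
    exact ⟨k * g, by filter_upwards [hk, hψ] with x h1 h2; rw [h2, h1]⟩
  · obtain ⟨k, hk, m, hm⟩ := h.exists_side hw
    refine ⟨k, hk, m * g, ?_⟩
    filter_upwards [hm, hψ] with x h1 h2
    rw [h2, h1]
    split_ifs <;> simp [mul_assoc]

theorem Coloring.IsPotentialAt.exists_eq_mul (h : c.IsPotentialAt φ w) (h' : c.IsPotentialAt ψ w)
    (hc : ¬ D.IsCrossing w) : ∃ g, ∀ᶠ x in 𝓝[D.traceᶜ] w, φ x = ψ x * g := by
  by_cases hw : w ∈ D.trace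
  · obtain ⟨k, hk, -⟩ := exists_isSide hw hc
    obtain ⟨g, hg⟩ := h.eventually_eq_ite hw hc hk
    obtain ⟨m, hm⟩ := h'.eventually_eq_ite hw hc hk
    refine ⟨m⁻¹ * g, ?_⟩
    filter_upwards [hg, hm] with x h1 h2
    rw [h1, h2]
    split_ifs <;> group
  · obtain ⟨g, hg⟩ := h.eventually_eq hw
    obtain ⟨m, hm⟩ := h'.eventually_eq hw
    refine ⟨m⁻¹ * g, nhdsWithin_le_nhds ?_⟩
    filter_upwards [hg, hm] with x h1 h2
    rw [h1, h2]; group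

theorem Coloring.exists_isPotentialAt_of_not_isCrossing (c : D.Coloring n)
    (hc : ¬ D.IsCrossing w) : ∃ φ, ∀ᶠ x in 𝓝 w, c.IsPotentialAt φ x := by
  by_cases hw : w ∈ D.trace
  swap
  · refine ⟨fun _ => 1, ?_⟩
    filter_upwards [D.isCompact_trace.isClosed.isOpen_compl.mem_nhds hw] with x hx
    exact ⟨fun _ => ⟨1, by simp⟩, fun h => absurd h hx⟩
  obtain ⟨k, hk, -⟩ := exists_isSide hw hc
  have hne := eventually_nhdsWithin_iff.1 (hk.eventually_ne_zero hw hc)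
  refine ⟨fun x => if 0 < k x then reflection (c.colorAt w) else 1, ?_⟩
  filter_upwards [hk.eventually, c.eventually_colorAt_eq hc, hne]
    with x h1 h2 h3
  have hcont := h1.contDiffAt.continuousAt
  refine ⟨fun hx => ?_, fun hx => ⟨k, h1, 1, ?_⟩⟩
  · rcases lt_or_gt_of_ne (h3 hx) with h4 | h4
    · exact ⟨1, (hcont.eventually_lt_const h4).mono fun y hy => by simp [hy.le]⟩
    · exact ⟨reflection (c.colorAt w), (hcont.eventually_const_lt h4).mono fun y hy => by simp [hy]⟩
  · simp [h2 hx hw]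

/-- Near a crossing the diagram consists of the two axes of a chart, the overstrand `g = t` and the
understrands `f = s`. -/
theorem PassesOver.exists_isChart {s t : ℝ} (h : D.PassesOver s t) :
    ∃ f g, IsChart D.shadow D.shadow s t f g ∧ ∀ U ∈ 𝓝 s, ∀ V ∈ 𝓝 t,
      ∀ᶠ x in 𝓝 (D.shadow s), ∀ r, D.shadow r = x →
        (∃ u ∈ U, D.curve u = D.curve r ∧ f x = u ∧ g x = t) ∨
        (∃ v ∈ V, D.curve v = D.curve r ∧ f x = s ∧ g x = v) := by
  obtain ⟨f, g, hfg⟩ := KnotColoring.exists_isChart D.contDiff_shadow D.contDiff_shadow h.1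
    (D.transverse s t h.curve_ne h.1)
  refine ⟨f, g, hfg, fun U hU V hV => ?_⟩
  have hnhds : ∀ r, D.shadow r = D.shadow s → ∃ p, D.curve r = D.curve p ∧
      (U ∩ {u | f (D.shadow u) = u ∧ g (D.shadow u) = t}) ∪
        (V ∩ {v | f (D.shadow v) = s ∧ g (D.shadow v) = v}) ∈ 𝓝 p := by
    intro r hr
    rcases D.no_triple r s t hr h.1 with e | e | e
    · exact ⟨s, e, mem_of_superset (inter_mem hU hfg.eventually_left) subset_union_left⟩
    · exact absurd e h.curve_ne
    · exact ⟨t, e, mem_of_superset (inter_mem hV hfg.eventually_right) subset_union_right⟩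
  filter_upwards [D.eventually_exists_mem_of_shadow_eq hnhds] with x hx r hr
  obtain ⟨u, hu, hur⟩ := hx r hr
  have e : D.shadow u = x := (D.shadow_eq_of_curve_eq hur).trans hr
  rcases hu with ⟨huU, h1, h2⟩ | ⟨huV, h1, h2⟩
  · exact Or.inl ⟨u, huU, hur, e ▸ h1, e ▸ h2⟩
  · exact Or.inr ⟨u, huV, hur, e ▸ h1, e ▸ h2⟩

theorem eventually_ne_not_isCrossing (D : KnotDiagram) (w : Plane) :
    ∀ᶠ x in 𝓝[≠] w, ¬ D.IsCrossing x := by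
  by_cases hw : D.IsCrossing w
  swap
  · exact nhdsWithin_le_nhds (eventually_not_isCrossing hw)
  obtain ⟨s, t, hst, rfl⟩ := hw.exists_passesOver
  obtain ⟨f, g, h, hU⟩ := hst.exists_isChart
  filter_upwards [nhdsWithin_le_nhds (hU univ univ_mem univ univ_mem),
    nhdsWithin_le_nhds h.eventually_eq, self_mem_nhdsWithin] with x hx h3 hxw
  have hnot : ¬ (f x = s ∧ g x = t) := by
    rintro ⟨h1, h2⟩
    apply hxw
    rw [mem_singleton_iff, ← h3, h1, h2, hst.1]
    abel
  rintro ⟨r, r', hne, hr, hr'⟩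
  rcases hx r hr with ⟨u, -, hu, hf, hg⟩ | ⟨u, -, hu, hf, hg⟩ <;>
    rcases hx r' hr' with ⟨u', -, hu', hf', hg'⟩ | ⟨u', -, hu', hf', hg'⟩
  · exact hne (by rw [← hu, ← hu', ← hf, ← hf'])
  · exact hnot ⟨hf', hg⟩
  · exact hnot ⟨hf, hg'⟩
  · exact hne (by rw [← hu, ← hu', ← hg, ← hg'])

theorem eventually_ne_not_isCrossing_shadow (D : KnotDiagram) (s : ℝ) :
    ∀ᶠ u in 𝓝[≠] s, ¬ D.IsCrossing (D.shadow u) :=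
  (tendsto_nhdsWithin_iff.2 ⟨D.continuous_shadow.continuousAt.tendsto.mono_left nhdsWithin_le_nhds,
    (D.hasDerivAt_shadow s).eventually_ne (D.immersed s)⟩).eventually
    (D.eventually_ne_not_isCrossing (D.shadow s))

/-- Around a crossing, a potential is given by its values on the four quadrants. The crossing
relation is what makes it return to its first value after a full turn. -/
theorem Coloring.exists_isPotentialAt_of_passesOver (c : D.Coloring n) {s t : ℝ}
    (hst : D.PassesOver s t) : ∃ φ, ∀ᶠ x in 𝓝[≠] (D.shadow s), c.IsPotentialAt φ x := by
  obtain ⟨f, g, h, hU⟩ := hst.exists_isChart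
  obtain ⟨ε, hε, hs⟩ := Metric.eventually_nhds_iff_ball.1
    (eventually_nhdsWithin_iff.1 (D.eventually_ne_not_isCrossing_shadow s))
  obtain ⟨δ, hδ, ht⟩ := Metric.eventually_nhds_iff_ball.1
    (eventually_nhdsWithin_iff.1 (D.eventually_ne_not_isCrossing_shadow t))
  simp only [Real.ball_eq_Ioo, mem_compl_iff, mem_singleton_iff] at hs ht
  obtain ⟨Y, hY⟩ := exists_strand (D := D) (I := Ioo (s - ε) (s + ε)) isPreconnected_Ioo
    ⟨s, by constructor <;> linarith⟩ fun u hu => by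
      by_cases hus : u = s
      exacts [hus ▸ hst.curve_mem_visible, curve_mem_visible (hs u hu hus)]
  obtain ⟨X, hX⟩ := exists_strand (D := D) (I := Ioo (t - δ) t) isPreconnected_Ioo
    (nonempty_Ioo.2 (by linarith)) fun u hu =>
      curve_mem_visible (ht u ⟨hu.1, by linarith [hu.2]⟩ hu.2.ne)
  obtain ⟨Z, hZ⟩ := exists_strand (D := D) (I := Ioo t (t + δ)) isPreconnected_Ioo
    (nonempty_Ioo.2 (by linarith)) fun u hu =>
      curve_mem_visible (ht u ⟨by linarith [hu.1], hu.2⟩ hu.1.ne')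
  have hXYZ : c.color X + c.color Z = 2 * c.color Y := c.crossing s t X Y Z hst
    (hY s ⟨by linarith, by linarith⟩)
    (mem_of_superset (Ioo_mem_nhdsLT (by linarith)) hX)
    (mem_of_superset (Ioo_mem_nhdsGT (by linarith)) hZ)
  have hconj := reflection_conj hXYZ
  have hf0 : fderiv ℝ f (D.shadow s) ≠ 0 :=
    fderiv_ne_zero_of_eventually_eq h.contDiffAt_fst D.contDiff_shadow
      (h.eventually_left.mono fun u hu => hu.1)
  have hg0 : fderiv ℝ g (D.shadow s) ≠ 0 := by
    have := fderiv_ne_zero_of_eventually_eq (k := g) (a := D.shadow) (s := t)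
      (hst.1 ▸ h.contDiffAt_snd) D.contDiff_shadow (h.eventually_right.mono fun u hu => hu.2)
    rwa [← hst.1] at this
  -- The quadrant `f > s`, `g > t` gets the value `1`. From there the understrand `Z` (on `g > t`)
  -- or the overstrand `Y` is crossed to the adjacent quadrants, and `Y` then `X` to the opposite one.
  refine ⟨fun x => if 0 < f x - s then (if 0 < g x - t then 1 else reflection (c.color Y))
    else (if 0 < g x - t then reflection (c.color Z) else
      reflection (c.color X) * reflection (c.color Y)), ?_⟩
  have hbranch := eventually_eventually_nhds.2 (hU _ (Ioo_mem_nhds (show s - ε < s by linarith)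
    (show s < s + ε by linarith)) _ (Ioo_mem_nhds (show t - δ < t by linarith)
    (show t < t + δ by linarith)))
  filter_upwards [self_mem_nhdsWithin, nhdsWithin_le_nhds hbranch,
    nhdsWithin_le_nhds h.eventually_eq,
    nhdsWithin_le_nhds (eventually_contDiffAt_and_fderiv_ne_zero h.contDiffAt_fst hf0),
    nhdsWithin_le_nhds (eventually_contDiffAt_and_fderiv_ne_zero h.contDiffAt_snd hg0)]
    with x hxw hx hΨ ⟨hfx, hfx'⟩ ⟨hgx, hgx'⟩
  have hx0 := hx.self_of_nhds
  have hfg : f x = s → g x ≠ t := by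
    intro h1 h2
    apply hxw
    rw [mem_singleton_iff, ← hΨ, h1, h2, hst.1]
    abel
  have hcf := (hfx.continuousAt.sub_const s)
  have hcg := (hgx.continuousAt.sub_const t)
  have hfpos : 0 < f x - s → ∀ᶠ y in 𝓝 x, 0 < f y - s := hcf.eventually_const_lt
  have hfneg : f x - s < 0 → ∀ᶠ y in 𝓝 x, f y - s < 0 := hcf.eventually_lt_const
  have hgpos : 0 < g x - t → ∀ᶠ y in 𝓝 x, 0 < g y - t := hcg.eventually_const_lt
  have hgneg : g x - t < 0 → ∀ᶠ y in 𝓝 x, g y - t < 0 := hcg.eventually_lt_const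
  refine ⟨fun hxD => ?_, ?_⟩
  · have hf : f x - s ≠ 0 := fun h1 => hxD ⟨g x, by
      nth_rewrite 2 [← hΨ]; rw [sub_eq_zero.1 h1]; abel⟩
    have hg : g x - t ≠ 0 := fun h1 => hxD ⟨f x, by
      nth_rewrite 2 [← hΨ]; rw [sub_eq_zero.1 h1, hst.1]; abel⟩
    rcases lt_or_gt_of_ne hf with h1 | h1 <;> rcases lt_or_gt_of_ne hg with h2 | h2
    · refine ⟨reflection (c.color X) * reflection (c.color Y), ?_⟩
      filter_upwards [hfneg h1, hgneg h2] with y h3 h4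
      rw [if_neg h3.not_gt, if_neg h4.not_gt]
    · refine ⟨reflection (c.color Z), ?_⟩
      filter_upwards [hfneg h1, hgpos h2] with y h3 h4
      rw [if_neg h3.not_gt, if_pos h4]
    · refine ⟨reflection (c.color Y), ?_⟩
      filter_upwards [hfpos h1, hgneg h2] with y h3 h4
      rw [if_pos h3, if_neg h4.not_gt]
    · refine ⟨1, ?_⟩
      filter_upwards [hfpos h1, hgpos h2] with y h3 h4
      rw [if_pos h3, if_pos h4]
  · rintro ⟨r, hr⟩
    rcases hx0 r hr with ⟨u, hu, hur, hfu, hgu⟩ | ⟨v, hv, hvr, hfv, hgv⟩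
    · have hcol : c.colorAt x = c.color Y := by
        rw [← hr, ← D.shadow_eq_of_curve_eq hur, c.colorAt_shadow (hY u hu)]
      have hfs : f x - s ≠ 0 := fun h1 => hfg (sub_eq_zero.1 h1) hgu
      refine ⟨fun y => g y - t, ⟨hgx.sub contDiffAt_const, by rwa [fderiv_sub_const], ?_⟩, ?_⟩
      · filter_upwards [hx, hcf.eventually_ne hfs] with y h1 h2
        rintro ⟨r, hr⟩
        rcases h1 r hr with ⟨-, -, -, -, h3⟩ | ⟨-, -, -, h3, -⟩
        exacts [sub_eq_zero.2 h3, absurd (sub_eq_zero.2 h3) h2]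
      · rw [hcol]
        rcases lt_or_gt_of_ne hfs with h1 | h1
        · refine ⟨reflection (c.color X) * reflection (c.color Y), nhdsWithin_le_nhds ?_⟩
          filter_upwards [hfneg h1] with y h2
          rw [if_neg h2.not_gt, hconj]
        · refine ⟨reflection (c.color Y), nhdsWithin_le_nhds ?_⟩
          filter_upwards [hfpos h1] with y h2
          rw [if_pos h2, reflection_mul_self]
    · have hgt : g x - t ≠ 0 := fun h1 => hfg hfv (sub_eq_zero.1 h1)
      refine ⟨fun y => f y - s, ⟨hfx.sub contDiffAt_const, by rwa [fderiv_sub_const], ?_⟩, ?_⟩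
      · filter_upwards [hx, hcg.eventually_ne hgt] with y h1 h2
        rintro ⟨r, hr⟩
        rcases h1 r hr with ⟨-, -, -, -, h3⟩ | ⟨-, -, -, h3, -⟩
        exacts [absurd (sub_eq_zero.2 h3) h2, sub_eq_zero.2 h3]
      · rw [← hr, ← D.shadow_eq_of_curve_eq hvr]
        rcases lt_or_gt_of_ne hgt with h1 | h1
        · rw [c.colorAt_shadow (hX v ⟨hv.1, by linarith⟩)]
          refine ⟨reflection (c.color X) * reflection (c.color Y), nhdsWithin_le_nhds ?_⟩
          rw [D.shadow_eq_of_curve_eq hvr, hr]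
          filter_upwards [hgneg h1] with y h2
          rw [if_neg h2.not_gt, if_neg h2.not_gt, ← mul_assoc, reflection_mul_self, one_mul]
        · rw [c.colorAt_shadow (hZ v ⟨by linarith, hv.2⟩)]
          refine ⟨reflection (c.color Z), nhdsWithin_le_nhds ?_⟩
          rw [D.shadow_eq_of_curve_eq hvr, hr]
          filter_upwards [hgpos h1] with y h2
          rw [if_pos h2, if_pos h2, reflection_mul_self]

theorem Coloring.exists_isPotentialAt_rect (c : D.Coloring n) {x₀ x₁ y₀ y₁ : ℝ} (hx : x₀ ≤ x₁)
    (hy : y₀ ≤ y₁) :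
    ∃ φ, ∀ w ∈ rect x₀ x₁ y₀ y₁, ¬ D.IsCrossing w → c.IsPotentialAt φ w := by
  have hloc : ∀ w, ∃ φ, ∀ᶠ x in 𝓝 w, ¬ D.IsCrossing x → c.IsPotentialAt φ x := by
    intro w
    by_cases hw : D.IsCrossing w
    · obtain ⟨s, t, hst, rfl⟩ := hw.exists_passesOver
      obtain ⟨φ, hφ⟩ := c.exists_isPotentialAt_of_passesOver hst
      refine ⟨φ, (eventually_nhdsWithin_iff.1 hφ).mono fun x h hx => h fun e => hx ?_⟩
      rwa [mem_singleton_iff.1 e]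
    · obtain ⟨φ, hφ⟩ := c.exists_isPotentialAt_of_not_isCrossing hw
      exact ⟨φ, hφ.mono fun x h _ => h⟩
  choose μ hμ using hloc
  obtain ⟨φ, hφ⟩ := exists_flatAt_rect (O := D.traceᶜ) (μ := μ) D.dense_compl_trace
    (fun w => by
      filter_upwards [hμ w, eventually_nhdsWithin_iff.1 (D.eventually_ne_not_isCrossing w)]
        with x h1 h2
      by_cases hxw : x = w
      · exact ⟨1, by simp [hxw]⟩
      · exact (h1 (h2 hxw)).exists_eq_mul ((hμ x).self_of_nhds (h2 hxw)) (h2 hxw)) hx hy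
  refine ⟨φ, fun w hw hc => ?_⟩
  obtain ⟨g, hg⟩ := hφ w hw
  exact ((hμ w).self_of_nhds hc).mul_right hg

end KnotDiagram

/-! ### Generic arcs -/

namespace KnotDiagram

variable {D : KnotDiagram} {n : ℕ}

theorem Region.subset_compl_trace (R : D.Region) : R.1 ⊆ D.traceᶜ := by
  obtain ⟨_, w, -, rfl⟩ := R
  exact connectedComponentIn_subset _ _

theorem Region.isOpen (R : D.Region) : IsOpen R.1 := by
  obtain ⟨_, w, -, rfl⟩ := R
  exact D.isCompact_trace.isClosed.isOpen_compl.connectedComponentIn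

theorem Region.isPathConnected (R : D.Region) : IsPathConnected R.1 := by
  rw [← R.isOpen.isConnected_iff_isPathConnected]
  obtain ⟨_, w, hw, rfl⟩ := R
  exact isConnected_connectedComponentIn_iff.2 hw

variable {R S : D.Region} {α : ℝ → Plane}

namespace IsGenericArc

theorem zero_notMem_hitTimes (h : D.IsGenericArc R S α) : (0 : ℝ) ∉ D.hitTimes α :=
  fun h0 => R.subset_compl_trace h.source h0.2

theorem one_notMem_hitTimes (h : D.IsGenericArc R S α) : (1 : ℝ) ∉ D.hitTimes α :=
  fun h0 => S.subset_compl_trace h.target h0.2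

theorem mem_Ioo_of_mem_hitTimes (h : D.IsGenericArc R S α) {t : ℝ} (ht : t ∈ D.hitTimes α) :
    t ∈ Ioo (0 : ℝ) 1 :=
  ⟨ht.1.1.lt_of_ne fun e => h.zero_notMem_hitTimes (e ▸ ht),
    ht.1.2.lt_of_ne fun e => h.one_notMem_hitTimes (e ▸ ht)⟩

theorem not_isCrossing (h : D.IsGenericArc R S α) {t : ℝ} (ht : t ∈ Icc (0 : ℝ) 1) :
    ¬ D.IsCrossing (α t) := by
  intro hc
  obtain ⟨s, -, -, hs, -⟩ := id hc
  exact h.not_crossing t ⟨ht, s, hs⟩ hc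

theorem exists_hasDerivAt (h : D.IsGenericArc R S α) {t : ℝ} (ht : t ∈ D.hitTimes α)
    {k : Plane → ℝ} (hk : D.IsSide k (α t)) :
    ∃ δ ≠ 0, HasDerivAt (fun u => k (α u)) δ t := by
  obtain ⟨s, hs⟩ := ht.2
  refine ⟨_, ?_, (hk.contDiffAt.differentiableAt (by simp)).hasFDerivAt.comp_hasDerivAt t
    (h.differentiableAt t ht).hasDerivAt⟩
  have hl := h.transverse t ht s hs
  rw [← hs] at hk ⊢
  exact hk.fderiv_ne_zero_of_linearIndependent (LinearIndependent.pair_symm_iff.1 hl)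

theorem eventually_notMem_trace (h : D.IsGenericArc R S α) {t : ℝ} (ht : t ∈ D.hitTimes α) :
    ∀ᶠ u in 𝓝[≠] t, α u ∈ D.traceᶜ := by
  obtain ⟨k, hk, -⟩ := exists_isSide ht.2 (h.not_crossing t ht)
  obtain ⟨δ, hδ, hd⟩ := h.exists_hasDerivAt ht hk
  filter_upwards [hd.eventually_ne (c := 0) hδ, nhdsWithin_le_nhds
    ((h.differentiableAt t ht).continuousAt.eventually hk.eventually_eq_zero)] with u h1 h2 h3
  exact h1 (h2 h3)

theorem finite_hitTimes (h : D.IsGenericArc R S α) : (D.hitTimes α).Finite := by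
  by_contra hinf
  obtain ⟨t, ht, hacc⟩ := Set.Infinite.exists_accPt_of_subset_isCompact hinf isCompact_Icc
    fun t ht => ht.1
  rw [accPt_iff_frequently_nhdsNE] at hacc
  by_cases hit : t ∈ D.hitTimes α
  · exact hacc ((h.eventually_notMem_trace hit).mono fun u hu hu' => hu hu'.2)
  · have hα : α t ∈ D.traceᶜ := fun h' => hit ⟨ht, h'⟩
    have := (h.continuousOn t ht).eventually
      (D.isCompact_trace.isClosed.isOpen_compl.mem_nhds hα)
    exact hacc <| nhdsWithin_le_nhds <| (eventually_nhdsWithin_iff.1 this).mono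
      fun u hu hu' => hu hu'.1 hu'.2

/-- When the arc meets the diagram, a potential along it is multiplied by the reflection in the
color of the strand, whichever side the arc comes from, as reflections are involutions. -/
theorem exists_reflection (h : D.IsGenericArc R S α) {c : D.Coloring n}
    {φ : Plane → Equiv.Perm (ZMod n)} {t : ℝ} (ht : t ∈ D.hitTimes α)
    (hφ : c.IsPotentialAt φ (α t)) :
    ∃ g, (∀ᶠ u in 𝓝[<] t, φ (α u) = g) ∧
      ∀ᶠ u in 𝓝[>] t, φ (α u) = reflection (c.colorAt (α t)) * g := by
  obtain ⟨k, hk, g, hg⟩ := hφ.exists_side ht.2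
  obtain ⟨δ, hδ, hd⟩ := h.exists_hasDerivAt ht hk
  have hk0 : k (α t) = 0 := hk.eventually_eq_zero.self_of_nhds ht.2
  have hφα : ∀ᶠ u in 𝓝[≠] t, φ (α u) =
      if 0 < k (α u) then reflection (c.colorAt (α t)) * g else g :=
    (tendsto_nhdsWithin_iff.2
      ⟨(h.differentiableAt t ht).continuousAt.tendsto.mono_left nhdsWithin_le_nhds,
        h.eventually_notMem_trace ht⟩).eventually hg
  rw [← nhdsLT_sup_nhdsGT, eventually_sup] at hφα
  have hslope := hasDerivAt_iff_tendsto_slope.1 hd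
  have hval : ∀ u, slope (fun u => k (α u)) t u = (u - t)⁻¹ * k (α u) := fun u => by
    simp [slope, hk0]
  rcases lt_or_gt_of_ne hδ with hneg | hpos
  · have hs := hslope.eventually_lt_const hneg
    rw [← nhdsLT_sup_nhdsGT, eventually_sup] at hs
    refine ⟨reflection (c.colorAt (α t)) * g, ?_, ?_⟩
    · filter_upwards [hφα.1, hs.1, self_mem_nhdsWithin] with u h1 h2 h3
      rw [hval] at h2
      have : 0 < k (α u) := by
        have := inv_lt_zero.2 (sub_neg.2 (mem_Iio.1 h3))
        nlinarith
      rw [h1, if_pos this]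
    · filter_upwards [hφα.2, hs.2, self_mem_nhdsWithin] with u h1 h2 h3
      rw [hval] at h2
      have : k (α u) < 0 := by
        have := inv_pos.2 (sub_pos.2 (mem_Ioi.1 h3))
        nlinarith
      rw [h1, if_neg this.not_gt, ← mul_assoc, reflection_mul_self, one_mul]
  · have hs := hslope.eventually_const_lt hpos
    rw [← nhdsLT_sup_nhdsGT, eventually_sup] at hs
    refine ⟨g, ?_, ?_⟩
    · filter_upwards [hφα.1, hs.1, self_mem_nhdsWithin] with u h1 h2 h3
      rw [hval] at h2
      have : k (α u) < 0 := by
        have := inv_lt_zero.2 (sub_neg.2 (mem_Iio.1 h3))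
        nlinarith
      rw [h1, if_neg this.not_gt]
    · filter_upwards [hφα.2, hs.2, self_mem_nhdsWithin] with u h1 h2 h3
      rw [hval] at h2
      have : 0 < k (α u) := by
        have := inv_pos.2 (sub_pos.2 (mem_Ioi.1 h3))
        nlinarith
      rw [h1, if_pos this]

/-- The alternating sum `c₁ - c₂ + ⋯ ± cₖ` is the image of `0` under the product of the reflections
in `c₁, …, cₖ`, and a potential turns this product into a ratio of its values at the endpoints. -/
theorem altSum_eq (h : D.IsGenericArc R S α) {c : D.Coloring n}
    {φ : Plane → Equiv.Perm (ZMod n)}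
    (hφ : ∀ t ∈ Icc (0 : ℝ) 1, c.IsPotentialAt φ (α t)) :
    c.altSum α = φ (α 0) ((φ (α 1))⁻¹ 0) := by
  classical
  set F := h.finite_hitTimes.toFinset with hF
  have hmem : ∀ {t}, t ∈ F ↔ t ∈ D.hitTimes α := h.finite_hitTimes.mem_toFinset
  set N : ℝ → ℕ := fun t => (F.filter (· < t)).card with hN
  set A : ℝ → ZMod n := fun t => ∑ s ∈ F.filter (· < t), (-1) ^ N s * c.colorAt (α s) with hA
  -- `v ↦ A t + (-1) ^ N t * v` is the composite of the reflections in the colors met before `t`,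
  -- so `M t` composes it with `φ (α t)`; this is constant along the arc and equals `φ (α 0)`.
  set M : ℝ → ZMod n → ZMod n := fun t v => A t + (-1) ^ N t * φ (α t) v with hM
  have hsum : c.altSum α = A 1 := by
    rw [Coloring.altSum, finsum_mem_eq_finite_toFinset_sum _ h.finite_hitTimes, hA]
    have h1 : F.filter (· < 1) = F := Finset.filter_true_of_mem fun t ht =>
      (h.mem_Ioo_of_mem_hitTimes (hmem.1 ht)).2
    simp only [h1]
    refine Finset.sum_congr rfl fun t ht => ?_
    have h2 : {s ∈ D.hitTimes α | s < t} = ↑(F.filter (· < t)) := by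
      ext s
      simp [hmem]
    rw [h2, ncard_coe_finset]
  have h0 : F.filter (· < 0) = ∅ := Finset.filter_false_of_mem fun t ht =>
    (h.mem_Ioo_of_mem_hitTimes (hmem.1 ht)).1.le.not_gt
  have hM0 : M 0 = φ (α 0) := by
    funext v
    simp [hM, hA, hN, h0]
  have hregular : ∀ t ∈ Icc (0 : ℝ) 1, t ∉ D.hitTimes α →
      ∀ᶠ u in 𝓝[Icc 0 1] t, M u = M t := by
    intro t ht hit
    obtain ⟨g, hg⟩ := (hφ t ht).eventually_eq fun h' => hit ⟨ht, h'⟩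
    have hfil : ∀ᶠ u in 𝓝 t, F.filter (· < u) = F.filter (· < t) := by
      have : ∀ᶠ u in 𝓝 t, ∀ r ∈ F, (r < u ↔ r < t) := by
        refine (eventually_all_finset F).2 fun r hr => ?_
        rcases lt_or_gt_of_ne (fun e : r = t => hit (e ▸ hmem.1 hr)) with h1 | h1
        · filter_upwards [lt_mem_nhds h1] with u hu using iff_of_true hu h1
        · filter_upwards [gt_mem_nhds h1] with u hu using iff_of_false hu.not_gt h1.not_gt
      exact this.mono fun u hu => Finset.filter_congr hu
    filter_upwards [nhdsWithin_le_nhds hfil, (h.continuousOn t ht).eventually hg] with u h1 h2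
    have h3 := hg.self_of_nhds
    funext v
    simp only [hM, hA, hN, h1, h2, h3]
  -- At a hit, the new reflection in `N` and `A` cancels the jump of `φ`, by
  -- `A + (-1) ^ N * col + (-1) ^ (N + 1) * (col - g v) = A + (-1) ^ N * g v`.
  have hhit : ∀ t ∈ D.hitTimes α, ∃ m, ∀ᶠ u in 𝓝[≠] t, M u = m := by
    intro t ht
    obtain ⟨g, hl, hr⟩ := h.exists_reflection ht (hφ t ht.1)
    refine ⟨fun v => A t + (-1) ^ N t * g v, ?_⟩
    rw [← nhdsLT_sup_nhdsGT, eventually_sup]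
    constructor
    · have hfil : ∀ᶠ u in 𝓝[<] t, ∀ r ∈ F, (r < u ↔ r < t) := by
        refine (eventually_all_finset F).2 fun r hr => ?_
        rcases lt_or_ge r t with h1 | h1
        · filter_upwards [nhdsWithin_le_nhds (lt_mem_nhds h1)] with u hu using iff_of_true hu h1
        · filter_upwards [self_mem_nhdsWithin] with u hu
          exact iff_of_false ((mem_Iio.1 hu).trans_le h1).not_gt h1.not_gt
      filter_upwards [hfil, hl] with u h1 h2
      funext v
      simp only [hM, hA, hN, Finset.filter_congr h1, h2]
    · have hfil : ∀ᶠ u in 𝓝[>] t, ∀ r ∈ F, (r < u ↔ r ≤ t) := by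
        refine (eventually_all_finset F).2 fun r hr => ?_
        rcases le_or_gt r t with h1 | h1
        · filter_upwards [self_mem_nhdsWithin] with u hu
          exact iff_of_true (h1.trans_lt (mem_Ioi.1 hu)) h1
        · filter_upwards [nhdsWithin_le_nhds (gt_mem_nhds h1)] with u hu
          exact iff_of_false hu.not_gt h1.not_ge
      filter_upwards [hfil, hr] with u h1 h2
      have h3 : F.filter (· < u) = insert t (F.filter (· < t)) := by
        rw [Finset.filter_congr h1]
        ext r
        simp only [Finset.mem_filter, Finset.mem_insert, le_iff_eq_or_lt]
        constructor
        · rintro ⟨h4, h5 | h5⟩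
          exacts [Or.inl h5, Or.inr ⟨h4, h5⟩]
        · rintro (rfl | ⟨h4, h5⟩)
          exacts [⟨hmem.2 ht, Or.inl rfl⟩, ⟨h4, Or.inr h5⟩]
      have h4 : t ∉ F.filter (· < t) := by simp
      have hNu : N u = N t + 1 := by
        simp only [hN, h3, Finset.card_insert_of_notMem h4]
      have hAu : A u = (-1) ^ N t * c.colorAt (α t) + A t := by
        simp only [hA, h3, Finset.sum_insert h4]
      funext v
      simp only [hM, hNu, hAu, h2, Equiv.Perm.mul_apply, reflection_apply]
      ring
  set O : Set ℝ := Ioo 0 1 ∩ (D.hitTimes α)ᶜ with hO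
  have hOne : ∀ t ∈ Icc (0 : ℝ) 1, (𝓝[O] t).NeBot := by
    intro t ht
    rw [← mem_closure_iff_nhdsWithin_neBot]
    have hd : Dense (D.hitTimes α)ᶜ := h.finite_hitTimes.countable.dense_compl ℝ
    have := closure_mono (hd.open_subset_closure_inter (isOpen_Ioo (a := (0 : ℝ)) (b := 1)))
    rw [closure_Ioo zero_ne_one, closure_closure] at this
    exact this ht
  have hOI : O ⊆ Icc 0 1 := inter_subset_left.trans Ioo_subset_Icc_self
  have hreg' : ∀ t ∈ Icc (0 : ℝ) 1, t ∉ D.hitTimes α → ∀ᶠ u in 𝓝[O] t, M u = M t :=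
    fun t ht hit => nhdsWithin_mono t hOI (hregular t ht hit)
  have h01 : (0 : ℝ) ∈ Icc (0 : ℝ) 1 := by simp
  have h11 : (1 : ℝ) ∈ Icc (0 : ℝ) 1 := by simp
  have hend := eventually_eq_of_isPreconnected isPreconnected_Icc hOne (M := M) (fun t ht => by
    by_cases hit : t ∈ D.hitTimes α
    · obtain ⟨m, hm⟩ := hhit t hit
      have hOt : O ⊆ {t}ᶜ := fun u hu (e : u = t) => hu.2 (e ▸ hit)
      exact ⟨m, nhdsWithin_mono t hOt hm⟩
    · exact ⟨M t, hreg' t ht hit⟩) h01 h11 (hreg' 0 h01 h.zero_notMem_hitTimes)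
  have := hOne 1 h11
  obtain ⟨u, hu0, hu1⟩ := (hend.and (hreg' 1 h11 h.one_notMem_hitTimes)).exists
  have key := congrFun (hM0.symm.trans (hu0.symm.trans hu1)) ((φ (α 1))⁻¹ 0)
  rw [hsum, key]
  simp [hM]

/-- The potential used here is defined on a square which contains the two arcs and compact connected
sets joining their endpoints within the two regions; a potential is constant on such a set. -/
theorem altSum_eq_altSum (c : D.Coloring n) {β : ℝ → Plane} (hα : D.IsGenericArc R S α)
    (hβ : D.IsGenericArc R S β) : c.altSum α = c.altSum β := by
  have hpath : ∀ (Q : D.Region) {p q : Plane}, p ∈ Q.1 → q ∈ Q.1 →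
      ∃ K ⊆ Q.1, IsCompact K ∧ IsPreconnected K ∧ p ∈ K ∧ q ∈ K := by
    intro Q p q hp hq
    let γ := (Q.isPathConnected.joinedIn p hp q hq)
    refine ⟨range γ.somePath, range_subset_iff.2 γ.somePath_mem,
      isCompact_range γ.somePath.continuous, isPreconnected_range γ.somePath.continuous,
      ⟨0, by simp⟩, ⟨1, by simp⟩⟩
  obtain ⟨K, hKR, hK, hK', h1, h2⟩ := hpath R hα.source hβ.source
  obtain ⟨L, hLS, hL, hL', h3, h4⟩ := hpath S hα.target hβ.target
  have hcomp := ((isCompact_Icc.image_of_continuousOn hα.continuousOn).union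
    (isCompact_Icc.image_of_continuousOn hβ.continuousOn)).union (hK.union hL)
  obtain ⟨C, hC0, hC⟩ := hcomp.isBounded.exists_pos_norm_le
  obtain ⟨φ, hφ⟩ := c.exists_isPotentialAt_rect (x₀ := -C) (x₁ := C) (y₀ := -C) (y₁ := C)
    (by linarith) (by linarith)
  have hrect : ∀ {w : Plane}, ‖w‖ ≤ C → w ∈ rect (-C) C (-C) C := fun {w} hw =>
    ⟨abs_le.1 ((PiLp.norm_apply_le w 0).trans hw), abs_le.1 ((PiLp.norm_apply_le w 1).trans hw)⟩
  have hconst : ∀ {Q : D.Region} {K : Set Plane}, K ⊆ Q.1 → IsPreconnected K →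
      (∀ w ∈ K, ‖w‖ ≤ C) → ∀ {p q}, p ∈ K → q ∈ K → φ p = φ q := by
    intro Q K hKQ hK hKC p q hp hq
    have hloc : ∀ w ∈ K, ∃ m, ∀ᶠ x in 𝓝[univ] w, φ x = m := by
      intro w hw
      have hwD := Q.subset_compl_trace (hKQ hw)
      rw [nhdsWithin_univ]
      exact (hφ w (hrect (hKC w hw)) fun ⟨s, _, _, hs, _⟩ => hwD ⟨s, hs⟩).eventually_eq hwD
    obtain ⟨m, hm⟩ := hloc p hp
    have := eventually_eq_of_isPreconnected hK (fun w _ => by rw [nhdsWithin_univ]; infer_instance)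
      hloc hp hq hm
    rw [nhdsWithin_univ] at hm this
    exact hm.self_of_nhds.trans this.self_of_nhds.symm
  have e0 : φ (α 0) = φ (β 0) :=
    hconst hKR hK' (fun w hw => hC w (Or.inr (Or.inl hw))) h1 h2
  have e1 : φ (α 1) = φ (β 1) :=
    hconst hLS hL' (fun w hw => hC w (Or.inr (Or.inr hw))) h3 h4
  rw [hα.altSum_eq fun t ht => hφ _ (hrect (hC _ (Or.inl (Or.inl ⟨t, ht, rfl⟩))))
      (hα.not_isCrossing ht),
    hβ.altSum_eq fun t ht => hφ _ (hrect (hC _ (Or.inl (Or.inr ⟨t, ht, rfl⟩))))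
      (hβ.not_isCrossing ht), e0, e1]

end IsGenericArc

theorem finite_isCrossing (D : KnotDiagram) : {w | D.IsCrossing w}.Finite := by
  by_contra hinf
  obtain ⟨w, -, hacc⟩ := Set.Infinite.exists_accPt_of_subset_isCompact hinf D.isCompact_trace
    fun w ⟨s, _, _, hs, _⟩ => ⟨s, hs⟩
  rw [accPt_iff_frequently_nhdsNE] at hacc
  exact hacc (D.eventually_ne_not_isCrossing w)

/-- Sard's theorem for the function `ℓ` on the knot: almost every line `ℓ = y` is transverse to the
diagram and avoids the crossings. -/
theorem dense_regularValues (D : KnotDiagram) (ℓ : Plane →L[ℝ] ℝ) :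
    Dense {y : ℝ | (∀ s, ℓ (D.shadow s) = y → ℓ (deriv D.shadow s) ≠ 0) ∧
      ∀ w, D.IsCrossing w → ℓ w ≠ y} := by
  have hd : ∀ s, HasDerivAt (fun s => ℓ (D.shadow s)) (ℓ (deriv D.shadow s)) s := fun s =>
    ℓ.hasFDerivAt.comp_hasDerivAt s (D.hasDerivAt_shadow s)
  have h1 : MeasureTheory.volume
      ((fun s => ℓ (D.shadow s)) '' {s | ℓ (deriv D.shadow s) = 0}) = 0 := by
    refine MeasureTheory.addHaar_image_eq_zero_of_det_fderivWithin_eq_zero _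
      (fun s _ => (hd s).hasFDerivAt.hasFDerivWithinAt) fun s hs => ?_
    have h0 : ℓ (deriv D.shadow s) = 0 := hs
    rw [h0]
    simp [ContinuousLinearMap.det]
  have h2 : MeasureTheory.volume (ℓ '' {w | D.IsCrossing w}) = 0 :=
    (D.finite_isCrossing.image ℓ).measure_zero _
  have := MeasureTheory.Measure.dense_of_ae (μ := MeasureTheory.volume)
    ((MeasureTheory.measure_eq_zero_iff_ae_notMem.1 h1).and
      (MeasureTheory.measure_eq_zero_iff_ae_notMem.1 h2))
  refine this.mono fun y hy => ⟨fun s hs h0 => hy.1 ⟨s, h0, hs⟩, fun w hw e => hy.2 ⟨w, hw, e⟩⟩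

/-- The arc is a straight segment: a segment joining the regions is moved to a nearby parallel one
which is transverse to the diagram. -/
theorem exists_isGenericArc (R S : D.Region) : ∃ α, D.IsGenericArc R S α := by
  obtain ⟨p, hp⟩ := R.isPathConnected.nonempty
  -- The endpoints are distinct even if `R = S`, so that the segment is injective.
  obtain ⟨q, hq, hpq⟩ : ∃ q ∈ S.1, q ≠ p := by
    obtain ⟨q, hq⟩ := S.isPathConnected.nonempty
    have := (mem_closure_iff_frequently.1 ((dense_compl_singleton p) q)).and_eventually
      (S.isOpen.mem_nhds hq)
    obtain ⟨x, h1, h2⟩ := this.exists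
    exact ⟨x, h2, h1⟩
  set θ : Plane := q - p with hθ
  have hθ0 : θ ≠ 0 := sub_ne_zero.2 hpq
  let ℓ : Plane →L[ℝ] ℝ := θ 1 • EuclideanSpace.proj (𝕜 := ℝ) (0 : Fin 2) -
    θ 0 • EuclideanSpace.proj (𝕜 := ℝ) (1 : Fin 2)
  have hℓ : ∀ x, ℓ x = θ 1 * x 0 - θ 0 * x 1 := fun x => rfl
  have hℓθ : ℓ θ = 0 := by rw [hℓ]; ring
  obtain ⟨ν, hν⟩ : ∃ ν, ℓ ν = 1 := by
    by_contra! hcon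
    apply hθ0
    have h0 : ∀ x, ℓ x = 0 := fun x => by
      by_contra hx
      exact hcon ((ℓ x)⁻¹ • x) (by simp [hx])
    ext i
    fin_cases i
    · simpa [hℓ] using h0 !₂[0, 1]
    · simpa [hℓ] using h0 !₂[1, 0]
  have hnear : ∀ (Q : D.Region) {x : Plane}, x ∈ Q.1 →
      ∀ᶠ y in 𝓝 (ℓ p), x + (y - ℓ p) • ν ∈ Q.1 := by
    intro Q x hx
    have hc : Continuous fun y : ℝ => x + (y - ℓ p) • ν := by fun_prop
    exact hc.continuousAt.eventually (Q.isOpen.mem_nhds (by simpa using hx))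
  obtain ⟨y, ⟨hreg, hcr⟩, hyp, hyq⟩ := ((mem_closure_iff_frequently.1
    (D.dense_regularValues ℓ (ℓ p))).and_eventually ((hnear R hp).and (hnear S hq))).exists
  let α : ℝ → Plane := fun t => p + (y - ℓ p) • ν + t • θ
  have hα : ∀ t, HasDerivAt α θ t := fun t => by
    have := ((hasDerivAt_id t).smul_const θ).const_add (p + (y - ℓ p) • ν)
    rwa [one_smul] at this
  have hℓα : ∀ t, ℓ (α t) = y := fun t => by simp [α, hν, hℓθ]
  refine ⟨α, ⟨fun t _ => (hα t).continuousAt.continuousWithinAt, ?_, ?_, ?_,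
    fun t _ hc => hcr _ hc (hℓα t), fun t _ => (hα t).differentiableAt, ?_⟩⟩
  · intro s _ t _ hst
    exact smul_left_injective ℝ hθ0 (add_left_cancel hst)
  · simpa [α] using hyp
  · have : α 1 = q + (y - ℓ p) • ν := by simp only [α, hθ, one_smul]; abel
    rwa [this]
  · intro t _ s hs
    have hne := hreg s (by rw [hs, hℓα])
    rw [(hα t).deriv, LinearIndependent.pair_iff]
    intro a b hab
    have hb : b = 0 := by
      have := congrArg ℓ hab
      simpa [hℓθ, hne] using this
    subst hb
    exact ⟨by simpa [hθ0] using hab, rfl⟩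

end KnotDiagram

end KnotColoring

end

theorem mainTheorem7 (D : KnotColoring.KnotDiagram) (n : ℕ) (c : D.Coloring n) :
    ∃! d : D.Region → D.Region → ZMod n, ∀ R S : D.Region,
      (∃ α : ℝ → KnotColoring.Plane, D.IsGenericArc R S α) ∧
      ∀ α : ℝ → KnotColoring.Plane, D.IsGenericArc R S α →
        (D.hitTimes α).Finite ∧ c.altSum α = d R S := by
  choose arc harc using fun R S : D.Region => KnotColoring.KnotDiagram.exists_isGenericArc R S
  refine ⟨fun R S => c.altSum (arc R S), fun R S => ⟨⟨_, harc R S⟩, fun α hα =>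
    ⟨hα.finite_hitTimes, hα.altSum_eq_altSum c (harc R S)⟩⟩, fun d hd => ?_⟩
  funext R S
  exact ((hd R S).2 _ (harc R S)).2.symm
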